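/- Let $n,m\ge 1$ and let $\Phi:M_n(\mathbb{C})\to M_m(\mathbb{C})$ be a channel, that is, a completely positive trace-preserving linear map, whose Choi matrix $J(\Phi)=\sum_{i,j=1}^n E_{ij}\otimes\Phi(E_{ij})$ is an (orthogonal) projection of rank $d$. Let $\{K_i\}_{i=1}^{r}\subseteq M_{m\times n}(\mathbb{C})$ be any minimal family of Kraus operators for $\Phi$, that is, $\Phi(X)=\sum_{i=1}^r K_iXK_i^*$ for all $X$ with the least possible number $r$ of operators; let $\Phi^C:M_n(\mathbb{C})\to M_r(\mathbb{C})$, $\Phi^C(X)=\sum_{i,j=1}^{r}\operatorname{tr}(K_i^*K_jX)E_{ji}$, be the resulting complementary channel, and let $\Phi^{C\dagger}$ be its dual, defined by $\operatorname{tr}(\Phi^{C\dagger}(X)Y)=\operatorname{tr}(X\Phi^C(Y))$. Write $$\mathcal{M}(\Phi^{C\dagger})=\{A\in M_r(\mathbb{C}):\ \Phi^{C\dagger}(AX)=\Phi^{C\dagger}(A)\Phi^{C\dagger}(X)\ \text{and}\ \Phi^{C\dagger}(XA)=\Phi^{C\dagger}(X)\Phi^{C\dagger}(A)\ \text{for all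 } X\in M_r(\mathbb{C})\}$$ for its multiplicative domain. Then $\Phi$ is entanglement breaking (for every $k\ge1$ and every state $X\in M_k(\mathbb{C})\otimes M_n(\mathbb{C})$ the state $(\mathrm{id}_k\otimes\Phi)(X)$ is separable, i.e. a finite convex combination of product states) if and only if $\mathcal{M}(\Phi^{C\dagger})$ is unitarily equivalent to an algebra of the form $\bigoplus_{k=1}^M M_{j_k}(\mathbb{C})$ with positive integers $j_k$, that is, to the algebra of all block-diagonal matrices with blocks of sizes $j_1,\dots,j_M$ acting on $\bigoplus_{k=1}^M\mathbb{C}^{j_k}$, every block occurring with multiplicity one. Moreover, in this case $$\operatorname{EB-rank}(\Phi)=\operatorname{Choi-rank}(\Phi)=d,$$ where $\operatorname{Choi-rank}(\Phi)$ is the least number of operators in a family of Kraus operators for $\Phi$, and $\operatorname{EB-rank}(\Phi)$ is the least number of operators in a family of Kraus operators for $\Phi$ all of which have the form $uv^*$ with $u\in\mathbb{C}^m$, $v\in\mathbb{C}^n$. -/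

import Mathlib

open scoped Matrix Kronecker ComplexOrder

noncomputable section

namespace EntBreak

/-- `id_k ⊗ Φ` on `M_k ⊗ M_n`, identified with the matrices indexed by `Fin k × Fin n`
(the first factor indexes blocks): `Φ` is applied to each of the `k × k` blocks. -/
def ampliation (k : ℕ) {n m : ℕ}
    (Φ : Matrix (Fin n) (Fin n) ℂ →ₗ[ℂ] Matrix (Fin m) (Fin m) ℂ)
    (X : Matrix (Fin k × Fin n) (Fin k × Fin n) ℂ) :
    Matrix (Fin k × Fin m) (Fin k × Fin m) ℂ :=
  Matrix.of fun p q => Φ (Matrix.of fun x y => X (p.1, x) (q.1, y)) p.2 q.2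

/-- On elementary tensors `id_k ⊗ Φ` acts as it should. -/
theorem ampliation_kronecker (k : ℕ) {n m : ℕ}
    (Φ : Matrix (Fin n) (Fin n) ℂ →ₗ[ℂ] Matrix (Fin m) (Fin m) ℂ)
    (A : Matrix (Fin k) (Fin k) ℂ) (B : Matrix (Fin n) (Fin n) ℂ) :
    ampliation k Φ (A ⊗ₖ B) = A ⊗ₖ Φ B := by
  ext p q
  have h : (Matrix.of fun x y => (A ⊗ₖ B) (p.1, x) (q.1, y)) = A p.1 q.1 • B := by
    ext x y
    simp [Matrix.kroneckerMap_apply]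
  simp only [ampliation, Matrix.of_apply, h, map_smul]
  simp [Matrix.kroneckerMap_apply]

/-- Complete positivity: `id_k ⊗ Φ` preserves positive semidefiniteness for every `k`. -/
def IsCompletelyPositive {n m : ℕ}
    (Φ : Matrix (Fin n) (Fin n) ℂ →ₗ[ℂ] Matrix (Fin m) (Fin m) ℂ) : Prop :=
  ∀ (k : ℕ) (X : Matrix (Fin k × Fin n) (Fin k × Fin n) ℂ),
    X.PosSemidef → (ampliation k Φ X).PosSemidef

/-- A quantum channel: a completely positive trace-preserving linear map. -/
structure IsChannel {n m : ℕ}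
    (Φ : Matrix (Fin n) (Fin n) ℂ →ₗ[ℂ] Matrix (Fin m) (Fin m) ℂ) : Prop where
  completelyPositive : IsCompletelyPositive Φ
  tracePreserving : ∀ X, (Φ X).trace = X.trace

/-- A state (density matrix). -/
structure IsState {ι : Type*} [Fintype ι] (ρ : Matrix ι ι ℂ) : Prop where
  posSemidef : ρ.PosSemidef
  trace_eq_one : ρ.trace = 1

/-- A bipartite matrix is a separable state if it is a (finite) convex combination of
product states. -/
def IsSeparable {k m : ℕ} (X : Matrix (Fin k × Fin m) (Fin k × Fin m) ℂ) : Prop :=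
  ∃ (N : ℕ) (p : Fin N → ℝ) (ρ : Fin N → Matrix (Fin k) (Fin k) ℂ)
    (σ : Fin N → Matrix (Fin m) (Fin m) ℂ),
    (∀ i, 0 ≤ p i) ∧ ∑ i, p i = 1 ∧ (∀ i, IsState (ρ i)) ∧ (∀ i, IsState (σ i)) ∧
      X = ∑ i, (p i : ℂ) • (ρ i ⊗ₖ σ i)

/-- `Φ` is entanglement breaking: `(id_k ⊗ Φ)(X)` is separable for every `k ≥ 1` and every
state `X`. -/
def IsEntanglementBreaking {n m : ℕ}
    (Φ : Matrix (Fin n) (Fin n) ℂ →ₗ[ℂ] Matrix (Fin m) (Fin m) ℂ) : Prop :=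
  ∀ k : ℕ, 1 ≤ k → ∀ X : Matrix (Fin k × Fin n) (Fin k × Fin n) ℂ,
    IsState X → IsSeparable (ampliation k Φ X)

/-- The Choi matrix `J(Φ) = ∑ i j, E_ij ⊗ Φ(E_ij)`. -/
def choiMatrix {n m : ℕ}
    (Φ : Matrix (Fin n) (Fin n) ℂ →ₗ[ℂ] Matrix (Fin m) (Fin m) ℂ) :
    Matrix (Fin n × Fin m) (Fin n × Fin m) ℂ :=
  ∑ i, ∑ j, Matrix.single i j (1 : ℂ) ⊗ₖ Φ (Matrix.single i j 1)

/-- `K` is a family of Kraus operators for `Φ`: `Φ(X) = ∑ i, K_i X K_i^*`. -/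
def IsKraus {n m r : ℕ}
    (Φ : Matrix (Fin n) (Fin n) ℂ →ₗ[ℂ] Matrix (Fin m) (Fin m) ℂ)
    (K : Fin r → Matrix (Fin m) (Fin n) ℂ) : Prop :=
  ∀ X, Φ X = ∑ i, K i * X * (K i)ᴴ

/-- `K` is a family of Kraus operators for `Φ` with the least possible number of members. -/
def IsMinimalKraus {n m r : ℕ}
    (Φ : Matrix (Fin n) (Fin n) ℂ →ₗ[ℂ] Matrix (Fin m) (Fin m) ℂ)
    (K : Fin r → Matrix (Fin m) (Fin n) ℂ) : Prop :=
  IsKraus Φ K ∧ ∀ (s : ℕ) (L : Fin s → Matrix (Fin m) (Fin n) ℂ), IsKraus Φ L → r ≤ s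

/-- The Choi rank: the least number of Kraus operators. -/
def choiRank {n m : ℕ}
    (Φ : Matrix (Fin n) (Fin n) ℂ →ₗ[ℂ] Matrix (Fin m) (Fin m) ℂ) : ℕ :=
  sInf {r | ∃ K : Fin r → Matrix (Fin m) (Fin n) ℂ, IsKraus Φ K}

/-- The entanglement breaking rank: the least number of Kraus operators in a Kraus
decomposition whose members are all of the form `u v^*`. -/
def ebRank {n m : ℕ}
    (Φ : Matrix (Fin n) (Fin n) ℂ →ₗ[ℂ] Matrix (Fin m) (Fin m) ℂ) : ℕ :=
  sInf {r | ∃ (u : Fin r → Fin m → ℂ) (v : Fin r → Fin n → ℂ),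
    IsKraus Φ fun i => Matrix.vecMulVec (u i) (star (v i))}

/-- The complement `Φ^C(X) = ∑ i j, tr(K_i^* K_j X) E_ji` determined by Kraus operators `K`. -/
def complement {n m r : ℕ} (K : Fin r → Matrix (Fin m) (Fin n) ℂ) :
    Matrix (Fin n) (Fin n) ℂ →ₗ[ℂ] Matrix (Fin r) (Fin r) ℂ where
  toFun X := ∑ i, ∑ j, ((K i)ᴴ * K j * X).trace • Matrix.single j i (1 : ℂ)
  map_add' X Y := by
    simp only [Matrix.mul_add, Matrix.trace_add, add_smul, Finset.sum_add_distrib]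
  map_smul' c X := by
    simp only [Matrix.mul_smul, Matrix.trace_smul, smul_assoc, Finset.smul_sum,
      RingHom.id_apply]

/-- The Hilbert-Schmidt dual `Φ†`, given by its entries; `trace_dual_mul` is its
defining property. -/
def dual {n m : ℕ}
    (Φ : Matrix (Fin n) (Fin n) ℂ →ₗ[ℂ] Matrix (Fin m) (Fin m) ℂ) :
    Matrix (Fin m) (Fin m) ℂ →ₗ[ℂ] Matrix (Fin n) (Fin n) ℂ where
  toFun X := Matrix.of fun i j => (X * Φ (Matrix.single j i 1)).trace
  map_add' X Y := by
    ext i j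
    simp [Matrix.add_mul]
  map_smul' c X := by
    ext i j
    simp

/-- `tr(Φ†(X) Y) = tr(X Φ(Y))`. -/
theorem trace_dual_mul {n m : ℕ}
    (Φ : Matrix (Fin n) (Fin n) ℂ →ₗ[ℂ] Matrix (Fin m) (Fin m) ℂ)
    (X : Matrix (Fin m) (Fin m) ℂ) (Y : Matrix (Fin n) (Fin n) ℂ) :
    (dual Φ X * Y).trace = (X * Φ Y).trace := by
  have h : ∀ i j : Fin n, ∀ c : ℂ,
      Φ (Matrix.single i j c) = c • Φ (Matrix.single i j 1) := by
    intro i j c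
    rw [← map_smul, Matrix.smul_single, smul_eq_mul, mul_one]
  conv_rhs => rw [Matrix.matrix_eq_sum_single Y]
  simp only [map_sum, Matrix.mul_sum, Matrix.trace_sum]
  rw [Finset.sum_comm]
  simp only [Matrix.trace, Matrix.diag_apply, Matrix.mul_apply (M := dual Φ X)]
  refine Finset.sum_congr rfl fun i _ => Finset.sum_congr rfl fun j _ => ?_
  rw [h j i, Matrix.mul_smul]
  simp only [dual, LinearMap.coe_mk, AddHom.coe_mk, Matrix.of_apply, Matrix.trace,
    Matrix.diag_apply, Matrix.smul_apply, smul_eq_mul, ← Finset.mul_sum]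
  ring

/-- The multiplicative domain of a linear map between matrix algebras. -/
def multiplicativeDomain {n m : ℕ}
    (Φ : Matrix (Fin n) (Fin n) ℂ →ₗ[ℂ] Matrix (Fin m) (Fin m) ℂ) :
    Set (Matrix (Fin n) (Fin n) ℂ) :=
  {A | ∀ X, Φ (A * X) = Φ A * Φ X ∧ Φ (X * A) = Φ X * Φ A}

/-- The concrete algebra `⊕_k M_{j_k}(ℂ)` of all block-diagonal matrices with blocks of sizes
`j_k`, acting on `⊕_k ℂ^{j_k}` (so every block occurs with multiplicity one). -/
def directSumAlgebra {M : ℕ} (j : Fin M → ℕ) :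
    Set (Matrix (Σ k, Fin (j k)) (Σ k, Fin (j k)) ℂ) :=
  Set.range fun B : (∀ k, Matrix (Fin (j k)) (Fin (j k)) ℂ) => Matrix.blockDiagonal' B

/-- Unitary equivalence `S = U T U^*` of sets of operators, for a unitary `U` from `ℂ^κ`
onto `ℂ^ι`. -/
def UnitarilyEquivalent {ι κ : Type*} [Fintype ι] [Fintype κ] [DecidableEq ι] [DecidableEq κ]
    (S : Set (Matrix ι ι ℂ)) (T : Set (Matrix κ κ ℂ)) : Prop :=
  ∃ U : Matrix ι κ ℂ, U * Uᴴ = 1 ∧ Uᴴ * U = 1 ∧ S = (fun B => U * B * Uᴴ) '' T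

end EntBreak

end

namespace EntBreak

open Matrix

/-! Write `J(Φ) = W Wᴴ`, where the columns of `W` are the vectorized operators of a minimal Kraus
family. Since `J(Φ)` is a projection, its rank equals the size of the family and `Wᴴ W = 1`. Hence Ψ
= Φ^{C†}, given by Ψ(A) = ∑ A_ij K_i^* K_j, preserves the trace; it is unital because Φ preserves
the trace.

For T_c = ∑ conj(c_i) K_i one has Ψ(cc^*) = T_c^* T_c. The heart of the proof is that, for a unit
vector c, the operator T_c has rank one exactly when cc^* lies in the multiplicative domain of Ψ. If
cc^* lies there, T_c^* T_c is a projection of trace one (`exists_krausCombination_eq_vecMulVec`). If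
T_c has rank one, trace preservation gives Ψ((cc^*)²) = Ψ(cc^*)², and equality in the
Kadison–Schwarz inequality applies (`vecMulVec_mem_multiplicativeDomain`).

Entanglement breaking means having rank-one Kraus operators. Expressed through the minimal family,
these give vectors c_l with ∑ c_l c_l^* = 1 and every c_l c_l^* in the domain. Gram–Schmidt can be
run inside this star algebra (`exists_orthonormal_of_spanning`) and yields an orthonormal basis
whose projections lie in it; such an algebra is a multiplicity-free direct sum. Conversely, a basis
of this kind rotates the minimal family unitarily into a rank-one family of the same size, which
also gives the equality of the ranks. -/

/-! ### Projections, isometries and rank-one factorizations. -/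

/-- An orthogonal projection is `Q Qᴴ` for a matrix `Q` with orthonormal columns, as many as
the rank. -/
theorem exists_isometry_of_isStarProjection {ι : Type*} [Fintype ι] [DecidableEq ι]
    {P : Matrix ι ι ℂ} (hP : IsStarProjection P) {d : ℕ} (hd : P.rank = d) :
    ∃ Q : Matrix ι (Fin d) ℂ, Q * Qᴴ = P ∧ Qᴴ * Q = 1 := by
  have hH : P.IsHermitian := hP.isSelfAdjoint
  let U : Matrix ι ι ℂ := (hH.eigenvectorUnitary).1
  have hUU : Uᴴ * U = 1 := Unitary.coe_star_mul_self hH.eigenvectorUnitary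
  have hspec : P = U * diagonal (RCLike.ofReal ∘ hH.eigenvalues) * Uᴴ := by
    have := hH.spectral_theorem
    rw [Unitary.conjStarAlgAut_apply] at this
    exact this
  have hD : diagonal (RCLike.ofReal ∘ hH.eigenvalues) = Uᴴ * P * U := by
    conv_rhs => rw [hspec]
    simp only [← Matrix.mul_assoc, hUU, Matrix.one_mul]
    rw [Matrix.mul_assoc, hUU, Matrix.mul_one]
  have hDD : diagonal (RCLike.ofReal ∘ hH.eigenvalues : ι → ℂ) *
      diagonal (RCLike.ofReal ∘ hH.eigenvalues) = diagonal (RCLike.ofReal ∘ hH.eigenvalues) := by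
    have hUU' : U * Uᴴ = 1 := mul_eq_one_comm.mp hUU
    have hPP : P * P = P := hP.isIdempotentElem
    rw [hD]
    calc Uᴴ * P * U * (Uᴴ * P * U) = Uᴴ * P * (U * Uᴴ) * P * U := by
          simp only [Matrix.mul_assoc]
      _ = Uᴴ * (P * P) * U := by rw [hUU', Matrix.mul_one, Matrix.mul_assoc Uᴴ P P]
      _ = Uᴴ * P * U := by rw [hPP]
  have hone : ∀ k, hH.eigenvalues k ≠ 0 → hH.eigenvalues k = 1 := by
    intro k hk
    rw [diagonal_mul_diagonal] at hDD
    have := congr_fun (congr_fun hDD k) k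
    simp only [diagonal_apply_eq, Function.comp_apply] at this
    have h2 : hH.eigenvalues k * hH.eigenvalues k = hH.eigenvalues k := by exact_mod_cast this
    exact mul_left_cancel₀ hk (by rw [h2, mul_one])
  -- The columns of `Q` are the eigenvectors with eigenvalue 1, and there are as many of them as the
  -- rank.
  let e : Fin d ≃ {i // hH.eigenvalues i ≠ 0} :=
    (Fintype.equivFinOfCardEq (hH.rank_eq_card_non_zero_eigs.symm.trans hd)).symm
  refine ⟨U.submatrix id fun k => (e k).1, ?_, ?_⟩
  · ext i j
    conv_rhs => rw [hspec]
    rw [Matrix.mul_apply, Matrix.mul_apply]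
    simp only [mul_diagonal, submatrix_apply, conjTranspose_apply, id]
    rw [e.sum_comp (fun k => U i k.1 * star (U j k.1)),
      ← Finset.sum_subtype (Finset.univ.filter fun k => hH.eigenvalues k ≠ 0)
        (by simp) (fun k => U i k * star (U j k)), Finset.sum_filter]
    refine Finset.sum_congr rfl fun k _ => ?_
    split_ifs with hk
    · simp [hone k hk]
    · simp [not_not.mp hk]
  · have := congrArg (fun M => M.submatrix (fun k => (e k).1) fun k => (e k).1) hUU
    have hinj : Function.Injective fun k => (e k).1 :=
      Subtype.val_injective.comp e.injective
    rw [submatrix_one _ hinj] at this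
    exact this

/-- A factorization of a projection with as many columns as the rank has orthonormal columns. -/
theorem conjTranspose_mul_self_eq_one_of_rank {ι : Type*} [Fintype ι] [DecidableEq ι]
    {P : Matrix ι ι ℂ} (hP : IsStarProjection P) {d : ℕ} (hd : P.rank = d)
    {W : Matrix ι (Fin d) ℂ} (hW : W * Wᴴ = P) : Wᴴ * W = 1 := by
  obtain ⟨Q, hQ, hQ1⟩  := exists_isometry_of_isStarProjection hP hd
  have hPP : P * P = P := hP.isIdempotentElem
  have hPW : P * W = W := by
    have : (1 - P) * (W * Wᴴ) = 0 := by rw [hW, Matrix.sub_mul, hPP, Matrix.one_mul, sub_self]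
    rw [mul_self_mul_conjTranspose_eq_zero, Matrix.sub_mul, Matrix.one_mul, sub_eq_zero] at this
    exact this.symm
  -- `Qᴴ * W` is square because `W` has exactly as many columns as the rank, so a one-sided inverse
  -- is two-sided.
  have hC : (Qᴴ * W) * (Qᴴ * W)ᴴ = 1 := by
    rw [conjTranspose_mul, conjTranspose_conjTranspose]
    calc Qᴴ * W * (Wᴴ * Q) = Qᴴ * (W * Wᴴ) * Q := by simp only [Matrix.mul_assoc]
      _ = (Qᴴ * Q) * (Qᴴ * Q) := by rw [hW, ← hQ]; simp only [Matrix.mul_assoc]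
      _ = 1 := by rw [hQ1, Matrix.one_mul]
  rw [mul_eq_one_comm, conjTranspose_mul, conjTranspose_conjTranspose] at hC
  calc Wᴴ * W = Wᴴ * (P * W) := by rw [hPW]
    _ = Wᴴ * Q * (Qᴴ * W) := by rw [← hQ]; simp only [Matrix.mul_assoc]
    _ = 1 := hC

/-- The rank of a projection is its trace. -/
theorem trace_eq_rank_of_isStarProjection {ι : Type*} [Fintype ι] [DecidableEq ι]
    {P : Matrix ι ι ℂ} (hP : IsStarProjection P) : P.trace = P.rank := by
  obtain ⟨Q, hQ, hQ1⟩ := exists_isometry_of_isStarProjection hP rfl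
  calc P.trace = (Q * Qᴴ).trace := by rw [hQ]
    _ = P.rank := by rw [trace_mul_comm, hQ1, trace_one, Fintype.card_fin]

/-- If `Tᴴ T` is a projection of trace one, then `T` has rank one. -/
theorem exists_eq_vecMulVec_of_trace_eq_one {ι κ : Type*} [Fintype ι] [Fintype κ]
    [DecidableEq κ] {T : Matrix ι κ ℂ} (hP : IsStarProjection (Tᴴ * T))
    (htr : (Tᴴ * T).trace = 1) : ∃ (u : ι → ℂ) (v : κ → ℂ), T = vecMulVec u (star v) := by
  have hr : (Tᴴ * T).rank = 1 := by
    rw [trace_eq_rank_of_isStarProjection hP] at htr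
    exact_mod_cast htr
  obtain ⟨Q, hQ, -⟩ := exists_isometry_of_isStarProjection hP hr
  have hPP : (Tᴴ * T) * (Tᴴ * T) = Tᴴ * T := hP.isIdempotentElem
  -- `T` is a partial isometry, so it factors through the one-column matrix `Q`.
  have hT : T * (Tᴴ * T) = T := by
    have : (Tᴴ * T) * (1 - Tᴴ * T) = 0 := by
      rw [Matrix.mul_sub, hPP, Matrix.mul_one, sub_self]
    rw [conjTranspose_mul_self_mul_eq_zero, Matrix.mul_sub, Matrix.mul_one, sub_eq_zero] at this
    exact this.symm
  refine ⟨fun i => (T * Q) i 0, fun j => Q j 0, ?_⟩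
  rw [← hQ, ← Matrix.mul_assoc] at hT
  conv_lhs => rw [← hT]
  ext i j
  rw [Matrix.mul_apply, Fin.sum_univ_one]
  rfl

theorem vecMulVec_mul_mul_vecMulVec {ι κ μ ν : Type*} [Fintype κ] [Fintype μ]
    (a : ι → ℂ) (b : κ → ℂ) (A : Matrix κ μ ℂ) (c : μ → ℂ) (d : ν → ℂ) :
    vecMulVec a b * A * vecMulVec c d = (b ⬝ᵥ A *ᵥ c) • vecMulVec a d := by
  rw [Matrix.mul_assoc, mul_vecMulVec, vecMulVec_mul_vecMulVec, vecMulVec_smul]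

/-! ### Star subalgebras containing rank-one projections. -/

/-- If the vectors `c l` span, and the operators `c l (c l)ᴴ` lie in a star subalgebra, then there
are orthonormal families of any size up to the dimension whose projections lie in it. -/
theorem exists_orthonormal_of_spanning {ι κ : Type*} [Fintype ι] [DecidableEq ι] [Fintype κ]
    (S : StarSubalgebra ℂ (Matrix ι ι ℂ)) (c : κ → ι → ℂ)
    (hc : ∑ l, vecMulVec (c l) (star (c l)) = 1)
    (hS : ∀ l, vecMulVec (c l) (star (c l)) ∈ S) (s : ℕ) (hs : s ≤ Fintype.card ι) :
    ∃ e : Fin s → ι → ℂ, (∀ i j, star (e i) ⬝ᵥ e j = if i = j then 1 else 0) ∧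
      ∀ i, vecMulVec (e i) (star (e i)) ∈ S := by
  induction s with
  | zero => exact ⟨fun i => i.elim0, fun i => i.elim0, fun i => i.elim0⟩
  | succ s ih =>
    obtain ⟨e, he, heS⟩ := ih (by omega)
    -- The projection onto the span found so far. It lies in `S`, so compressing by `1 - P` is a
    -- Gram–Schmidt step that stays in `S`.
    set P : Matrix ι ι ℂ := ∑ i, vecMulVec (e i) (star (e i)) with hPdef
    have hPS : P ∈ S := sum_mem fun i _ => heS i
    have hPstar : (1 - P)ᴴ = 1 - P := by
      simp [hPdef, conjTranspose_sub, conjTranspose_sum, conjTranspose_vecMulVec]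
    have hPe : ∀ i x, star (e i) ⬝ᵥ ((1 - P) *ᵥ x) = 0 := by
      intro i x
      rw [Matrix.sub_mulVec, one_mulVec, dotProduct_sub, hPdef, sum_mulVec, dotProduct_sum]
      simp only [vecMulVec_mulVec, dotProduct_smul, he, MulOpposite.smul_eq_mul_unop,
        MulOpposite.unop_op]
      simp
    have htr : P.trace = s := by
      rw [hPdef, trace_sum]
      simp [trace_vecMulVec, dotProduct_comm (e _), he]
    -- If `1 - P` killed every `c l`, then `hc` would give `P = 1`, and the trace would make `s` the
    -- full dimension.
    obtain ⟨l, hl⟩ : ∃ l, (1 - P) *ᵥ c l ≠ 0 := by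
      by_contra! h
      have h1 : (1 - P) * ∑ l, vecMulVec (c l) (star (c l)) = 0 := by
        rw [Matrix.mul_sum]
        exact Finset.sum_eq_zero fun l _ => by rw [mul_vecMulVec, h l, zero_vecMulVec]
      rw [hc, Matrix.mul_one, sub_eq_zero] at h1
      rw [← h1, trace_one] at htr
      have : Fintype.card ι = s := by exact_mod_cast htr
      omega
    set x := (1 - P) *ᵥ c l with hx
    have hxS : vecMulVec x (star x) ∈ S := by
      have : vecMulVec x (star x) = (1 - P) * vecMulVec (c l) (star (c l)) * (1 - P) := by
        rw [mul_vecMulVec, vecMulVec_mul, hx, star_mulVec, hPstar]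
      rw [this]
      exact mul_mem (mul_mem (sub_mem (one_mem S) hPS) (hS l)) (sub_mem (one_mem S) hPS)
    obtain ⟨t, ht⟩ : ∃ t : ℝ, star x ⬝ᵥ x = (t : ℂ) ∧ 0 < t := by
      have h0 : 0 < star x ⬝ᵥ x := dotProduct_star_self_pos_iff.mpr hl
      rw [Complex.lt_def] at h0
      refine ⟨(star x ⬝ᵥ x).re, ?_, by simpa using h0.1⟩
      apply Complex.ext <;> simp [← h0.2]
    obtain ⟨ht, ht0⟩ := ht
    set a : ℂ := (((Real.sqrt t)⁻¹ : ℝ) : ℂ) with ha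
    have haa : a * a * t = 1 := by
      rw [ha, ← Complex.ofReal_mul, ← Complex.ofReal_mul, ← Complex.ofReal_one, ← mul_inv,
        Real.mul_self_sqrt ht0.le, inv_mul_cancel₀ ht0.ne']
    have hsa : star a = a := Complex.conj_ofReal _
    refine ⟨Fin.cons (a • x) e, ?_, ?_⟩
    · intro i j
      refine Fin.cases ?_ (fun i => ?_) i <;> refine Fin.cases ?_ (fun j => ?_) j
      · simp only [Fin.cons_zero, star_smul, smul_dotProduct, dotProduct_smul, ht, smul_eq_mul,
          hsa, if_true]
        rw [← haa]; ring
      · have : star x ⬝ᵥ e j = 0 := by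
          have := congrArg star (hPe j (c l))
          rwa [star_dotProduct, star_star, star_zero, dotProduct_comm, ← hx, dotProduct_comm] at this
        simp [this, (Fin.succ_ne_zero j).symm, star_smul]
      · simp [dotProduct_smul, hPe, hx, Fin.succ_ne_zero]
      · simp [he, Fin.succ_inj]
    · intro i
      refine Fin.cases ?_ (fun i => ?_) i
      · simp only [Fin.cons_zero, star_smul, smul_vecMulVec, vecMulVec_smul]
        exact S.smul_mem (S.smul_mem hxS _) _
      · simpa using heS i

theorem mul_mul_conjTranspose_eq_sum {ι κ : Type*} [Fintype κ] (U : Matrix ι κ ℂ)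
    (B : Matrix κ κ ℂ) :
    U * B * Uᴴ = ∑ p, ∑ q, B p q • vecMulVec (fun x => U x p) (star fun x => U x q) := by
  ext x y
  simp only [Matrix.mul_apply, Matrix.sum_apply, Matrix.smul_apply, vecMulVec_apply,
    conjTranspose_apply, Pi.star_apply, smul_eq_mul, Finset.sum_mul]
  rw [Finset.sum_comm]
  exact Finset.sum_congr rfl fun p _ => Finset.sum_congr rfl fun q _ => by ring

/-- A star subalgebra that contains the projections onto the vectors of an orthonormal basis is
a direct sum of full matrix algebras, every summand with multiplicity one. -/
theorem exists_unitarilyEquivalent_directSumAlgebra {r : ℕ}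
    (S : StarSubalgebra ℂ (Matrix (Fin r) (Fin r) ℂ)) (e : Fin r → Fin r → ℂ)
    (he : ∀ i j, star (e i) ⬝ᵥ e j = if i = j then 1 else 0)
    (heS : ∀ i, vecMulVec (e i) (star (e i)) ∈ S) :
    ∃ (M : ℕ) (j : Fin M → ℕ), (∀ k, 1 ≤ j k) ∧
      UnitarilyEquivalent (S : Set (Matrix (Fin r) (Fin r) ℂ)) (directSumAlgebra j) := by
  classical
  -- The blocks are the classes of basis vectors linked by a matrix unit in `S`.
  let rel : Setoid (Fin r) :=
    { r := fun i j => vecMulVec (e i) (star (e j)) ∈ S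
      iseqv :=
        { refl := heS
          symm := fun {i j} h => by
            have := star_mem h
            rwa [star_eq_conjTranspose, conjTranspose_vecMulVec, star_star] at this
          trans := fun {i j k} h h' => by
            have := mul_mem h h'
            rwa [vecMulVec_mul_vecMulVec, he, if_pos rfl, one_smul] at this } }
  let f : Fin r → Fin (Fintype.card (Quotient rel)) := fun i =>
    Fintype.equivFin (Quotient rel) (Quotient.mk rel i)
  have hf : ∀ i j, f i = f j ↔ vecMulVec (e i) (star (e j)) ∈ S := fun i j =>
    (Fintype.equivFin (Quotient rel)).injective.eq_iff.trans Quotient.eq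
  let j : Fin (Fintype.card (Quotient rel)) → ℕ := fun k => Fintype.card {i // f i = k}
  let g : (Σ k, Fin (j k)) ≃ Fin r :=
    (Equiv.sigmaCongrRight fun k => (Fintype.equivFin {i // f i = k}).symm).trans
      (Equiv.sigmaFiberEquiv f)
  have hg : ∀ q, f (g q) = q.1 := fun q => ((Fintype.equivFin {i // f i = q.1}).symm q.2).2
  let U : Matrix (Fin r) (Σ k, Fin (j k)) ℂ := Matrix.of fun x q => e (g q) x
  have hUU : Uᴴ * U = 1 := by
    ext p q
    refine Eq.trans (he (g p) (g q)) ?_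
    simp only [Matrix.one_apply, g.injective.eq_iff]
  have hUU' : U * Uᴴ = 1 := (mul_eq_one_comm_of_equiv g).mp hUU
  refine ⟨_, j, fun k => ?_, U, hUU', hUU, ?_⟩
  · obtain ⟨x, hx⟩ := (Fintype.equivFin (Quotient rel)).surjective k
    obtain ⟨i, rfl⟩ := Quotient.exists_rep x
    exact Fintype.card_pos_iff.mpr ⟨⟨i, hx⟩⟩
  · ext A
    constructor
    · intro hA
      set D := Uᴴ * A * U with hD
      have hDA : U * D * Uᴴ = A := by
        calc U * D * Uᴴ = (U * Uᴴ) * A * (U * Uᴴ) := by rw [hD]; simp only [Matrix.mul_assoc]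
          _ = A := by rw [hUU', Matrix.one_mul, Matrix.mul_one]
      have hDpq : ∀ p q, D p q = star (e (g p)) ⬝ᵥ A *ᵥ e (g q) := by
        intro p q
        rw [hD, Matrix.mul_assoc]
        rfl
      refine ⟨D, ⟨fun k => Matrix.of fun a b => D ⟨k, a⟩ ⟨k, b⟩, ?_⟩, hDA⟩
      ext ⟨k, a⟩ ⟨k', b⟩
      by_cases hk : k = k'
      · subst hk
        simp [blockDiagonal'_apply_eq]
      · dsimp only
        rw [blockDiagonal'_apply_ne _ _ _ hk]
        by_contra hne
        -- Cutting `A` by two basis projections leaves a multiple of one matrix unit. A nonzero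
        -- entry off the blocks would put this unit into `S` and merge the two classes.
        have hmem := mul_mem (mul_mem (heS (g ⟨k, a⟩)) hA) (heS (g ⟨k', b⟩))
        rw [vecMulVec_mul_mul_vecMulVec, ← hDpq] at hmem
        have := S.smul_mem hmem (D ⟨k, a⟩ ⟨k', b⟩)⁻¹
        rw [smul_smul, inv_mul_cancel₀ (Ne.symm hne), one_smul, ← hf, hg, hg] at this
        exact hk this
    · rintro ⟨_, ⟨B, rfl⟩, rfl⟩
      dsimp only
      rw [mul_mul_conjTranspose_eq_sum]
      refine sum_mem fun p _ => sum_mem fun q _ => ?_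
      by_cases hk : p.1 = q.1
      · exact S.smul_mem ((hf (g p) (g q)).mp (by rw [hg, hg, hk])) _
      · obtain ⟨k, a⟩ := p
        obtain ⟨k', b⟩ := q
        rw [blockDiagonal'_apply_ne _ _ _ hk, zero_smul]
        exact zero_mem S

/-! ### Kraus families and the dual of the complement. -/

variable {n m r : ℕ}

theorem choiMatrix_apply (Φ : Matrix (Fin n) (Fin n) ℂ →ₗ[ℂ] Matrix (Fin m) (Fin m) ℂ)
    (p q : Fin n × Fin m) : choiMatrix Φ p q = Φ (single p.1 q.1 1) p.2 q.2 := by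
  simp only [choiMatrix, Matrix.sum_apply, kroneckerMap_apply, single_apply]
  rw [Finset.sum_eq_single p.1, Finset.sum_eq_single q.1]
  · simp
  · intro b _ hb
    simp [hb]
  · simp
  · intro b _ hb
    simp [hb]
  · simp

/-- The matrix whose columns are the vectorized Kraus operators. -/
def krausMatrix (K : Fin r → Matrix (Fin m) (Fin n) ℂ) : Matrix (Fin n × Fin m) (Fin r) ℂ :=
  Matrix.of fun p l => K l p.2 p.1

/-- Both sides are tested on matrix units, which determine a linear map. Choosing Kraus operators
thus becomes factoring the Choi matrix. -/
theorem isKraus_iff_choiMatrix (Φ : Matrix (Fin n) (Fin n) ℂ →ₗ[ℂ] Matrix (Fin m) (Fin m) ℂ)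
    (K : Fin r → Matrix (Fin m) (Fin n) ℂ) :
    IsKraus Φ K ↔ choiMatrix Φ = krausMatrix K * (krausMatrix K)ᴴ := by
  have key : ∀ i j a b, (∑ l, K l * single i j (1 : ℂ) * (K l)ᴴ : Matrix (Fin m) (Fin m) ℂ) a b =
      (krausMatrix K * (krausMatrix K)ᴴ) (i, a) (j, b) := by
    intro i j a b
    rw [Matrix.sum_apply, Matrix.mul_apply]
    refine Finset.sum_congr rfl fun l _ => ?_
    rw [Matrix.mul_apply, Finset.sum_eq_single j]
    · simp [krausMatrix]
    · intro c _ hc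
      rw [mul_single_apply_of_ne _ _ _ _ _ hc, zero_mul]
    · simp
  constructor
  · intro h
    ext p q
    rw [choiMatrix_apply, h, key]
  · intro h X
    let Ψ : Matrix (Fin n) (Fin n) ℂ →ₗ[ℂ] Matrix (Fin m) (Fin m) ℂ :=
      { toFun := fun X => ∑ l, K l * X * (K l)ᴴ
        map_add' := fun X Y => by
          simp only [Matrix.mul_add, Matrix.add_mul, Finset.sum_add_distrib]
        map_smul' := fun c X => by
          simp only [Matrix.mul_smul, Matrix.smul_mul, Finset.smul_sum, RingHom.id_apply] }
    suffices Φ = Ψ from congrArg (fun F => F X) this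
    refine Matrix.ext_linearMap _ fun i j => ?_
    refine LinearMap.ext_ring ?_
    ext a b
    change Φ (single i j 1) a b = (∑ l, K l * single i j (1 : ℂ) * (K l)ᴴ : Matrix (Fin m) (Fin m) ℂ) a b
    rw [key, ← h, choiMatrix_apply]

theorem dual_complement_eq_sum (K : Fin r → Matrix (Fin m) (Fin n) ℂ)
    (A : Matrix (Fin r) (Fin r) ℂ) :
    dual (complement K) A = ∑ i, ∑ j, A i j • ((K i)ᴴ * K j) := by
  ext x y
  have : ∀ Y, (A * complement K Y).trace = ∑ i, ∑ j, A i j * ((K i)ᴴ * K j * Y).trace := by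
    intro Y
    simp only [complement, LinearMap.coe_mk, AddHom.coe_mk, Matrix.mul_sum, Matrix.mul_smul,
      trace_sum, trace_smul, smul_eq_mul, trace_mul_single]
    refine Finset.sum_congr rfl fun i _ => Finset.sum_congr rfl fun j _ => ?_
    simp [mul_comm]
  simp only [dual, LinearMap.coe_mk, AddHom.coe_mk, Matrix.of_apply, this, trace_mul_single,
    Matrix.sum_apply, Matrix.smul_apply, smul_eq_mul]
  simp

/-- The operator `∑ i, conj (c i) K_i`. -/
def krausCombination (K : Fin r → Matrix (Fin m) (Fin n) ℂ) (c : Fin r → ℂ) :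
    Matrix (Fin m) (Fin n) ℂ :=
  ∑ i, star (c i) • K i

/-- This ties rank-one elements of the domain to single operators in the span of the Kraus family.
-/
theorem dual_complement_vecMulVec (K : Fin r → Matrix (Fin m) (Fin n) ℂ) (c : Fin r → ℂ) :
    dual (complement K) (vecMulVec c (star c)) =
      (krausCombination K c)ᴴ * krausCombination K c := by
  rw [dual_complement_eq_sum, krausCombination, conjTranspose_sum, Matrix.sum_mul]
  refine Finset.sum_congr rfl fun i _ => ?_
  rw [Matrix.mul_sum]
  refine Finset.sum_congr rfl fun j _ => ?_
  rw [conjTranspose_smul, star_star, Matrix.smul_mul, Matrix.mul_smul, smul_smul,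
    vecMulVec_apply, Pi.star_apply]

/-- The Stinespring operator `x ↦ ∑ i, e_i ⊗ K_i x`. -/
def stinespring (K : Fin r → Matrix (Fin m) (Fin n) ℂ) : Matrix (Fin r × Fin m) (Fin n) ℂ :=
  Matrix.of fun p x => K p.1 p.2 x

/-- The dual is a compression of the representation `A ↦ A ⊗ 1`, the form needed for the
Kadison–Schwarz argument. -/
theorem dual_complement_eq_stinespring (K : Fin r → Matrix (Fin m) (Fin n) ℂ)
    (A : Matrix (Fin r) (Fin r) ℂ) :
    dual (complement K) A =
      (stinespring K)ᴴ * (A ⊗ₖ (1 : Matrix (Fin m) (Fin m) ℂ)) * stinespring K := by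
  rw [dual_complement_eq_sum]
  ext x y
  rw [Matrix.mul_assoc, Matrix.mul_apply, Fintype.sum_prod_type]
  simp only [Matrix.sum_apply, Matrix.smul_apply, Matrix.mul_apply, Fintype.sum_prod_type,
    conjTranspose_apply, stinespring, Matrix.of_apply, kroneckerMap_apply, smul_eq_mul,
    Matrix.one_apply, mul_ite, mul_one, mul_zero, ite_mul, zero_mul, Finset.sum_ite_eq,
    Finset.mem_univ, if_true, Finset.mul_sum]
  refine Finset.sum_congr rfl fun i _ => ?_
  rw [Finset.sum_comm]
  exact Finset.sum_congr rfl fun a _ => Finset.sum_congr rfl fun j _ => by ring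

theorem dual_complement_conjTranspose (K : Fin r → Matrix (Fin m) (Fin n) ℂ)
    (A : Matrix (Fin r) (Fin r) ℂ) :
    dual (complement K) Aᴴ = (dual (complement K) A)ᴴ := by
  rw [dual_complement_eq_stinespring, dual_complement_eq_stinespring, conjTranspose_mul,
    conjTranspose_mul, conjTranspose_kronecker, conjTranspose_conjTranspose, conjTranspose_one,
    Matrix.mul_assoc]

/-- The dual of the complement of a trace-preserving map is unital. -/
theorem dual_complement_one {Φ : Matrix (Fin n) (Fin n) ℂ →ₗ[ℂ] Matrix (Fin m) (Fin m) ℂ}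
    (htr : ∀ X, (Φ X).trace = X.trace) {K : Fin r → Matrix (Fin m) (Fin n) ℂ}
    (hK : IsKraus Φ K) : dual (complement K) 1 = 1 := by
  ext x y
  have h := htr (single y x 1)
  rw [hK, trace_sum] at h
  rw [dual_complement_eq_sum]
  have : ∀ i, (K i * single y x (1 : ℂ) * (K i)ᴴ).trace = ((K i)ᴴ * K i) x y := by
    intro i
    rw [trace_mul_comm, ← Matrix.mul_assoc, trace_mul_single]
    simp
  simp only [this] at h
  simp only [Matrix.one_apply, ite_smul, one_smul, zero_smul, Finset.sum_ite_eq, Finset.mem_univ,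
    if_true, Matrix.sum_apply, h]
  by_cases hxy : x = y
  · subst hxy
    simp
  · rw [if_neg hxy]
    exact trace_single_eq_of_ne _ _ _ (Ne.symm hxy)

/-! ### The multiplicative domain. -/

/-- Equality in the Kadison–Schwarz inequality puts a Hermitian element into the multiplicative
domain. -/
theorem mem_multiplicativeDomain_of_isHermitian {K : Fin r → Matrix (Fin m) (Fin n) ℂ}
    (h1 : dual (complement K) 1 = 1) {A : Matrix (Fin r) (Fin r) ℂ} (hA : A.IsHermitian)
    (h : dual (complement K) (A * A) = dual (complement K) A * dual (complement K) A) :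
    A ∈ multiplicativeDomain (dual (complement K)) := by
  set Ψ := dual (complement K) with hΨ
  set V := stinespring K with hV
  have hst : ∀ B, Ψ B = Vᴴ * (B ⊗ₖ (1 : Matrix (Fin m) (Fin m) ℂ)) * V :=
    dual_complement_eq_stinespring K
  have hVV : Vᴴ * V = 1 := by
    rw [← h1, hst, one_kronecker_one, Matrix.mul_one]
  have hAH : (Ψ A)ᴴ = Ψ A := by rw [hΨ, ← dual_complement_conjTranspose, hA.eq]
  have hkH : (A ⊗ₖ (1 : Matrix (Fin m) (Fin m) ℂ))ᴴ = A ⊗ₖ 1 := by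
    rw [conjTranspose_kronecker, hA.eq, conjTranspose_one]
  have hkk : (A ⊗ₖ (1 : Matrix (Fin m) (Fin m) ℂ)) * A ⊗ₖ 1 = (A * A) ⊗ₖ 1 := by
    rw [← mul_kronecker_mul, Matrix.one_mul]
  -- With D = (A ⊗ 1)V - VΨ(A), the product D^*D equals Ψ(A²) - Ψ(A)², which vanishes by `h`.
  have hint : (A ⊗ₖ (1 : Matrix (Fin m) (Fin m) ℂ)) * V = V * Ψ A := by
    rw [← sub_eq_zero, ← conjTranspose_mul_self_eq_zero, conjTranspose_sub, conjTranspose_mul,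
      conjTranspose_mul, hkH, hAH, Matrix.sub_mul, Matrix.mul_sub, Matrix.mul_sub]
    have e1 : Vᴴ * (A ⊗ₖ (1 : Matrix (Fin m) (Fin m) ℂ)) * ((A ⊗ₖ (1 : Matrix (Fin m) (Fin m) ℂ)) * V) = Ψ A * Ψ A := by
      rw [← h, hst (A * A), ← hkk]
      simp only [Matrix.mul_assoc]
    have e2 : Vᴴ * (A ⊗ₖ (1 : Matrix (Fin m) (Fin m) ℂ)) * (V * Ψ A) = Ψ A * Ψ A := by
      conv_rhs => rw [hst A]
      rw [hst A]
      simp only [Matrix.mul_assoc]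
    have e3 : Ψ A * Vᴴ * ((A ⊗ₖ (1 : Matrix (Fin m) (Fin m) ℂ)) * V) = Ψ A * Ψ A := by
      conv_rhs => rw [hst A]
      rw [hst A]
      simp only [Matrix.mul_assoc]
    have e4 : Ψ A * Vᴴ * (V * Ψ A) = Ψ A * Ψ A := by
      rw [Matrix.mul_assoc, ← Matrix.mul_assoc Vᴴ, hVV, Matrix.one_mul]
    rw [e1, e2, e3, e4, sub_self]
  have hright : ∀ X, Ψ (X * A) = Ψ X * Ψ A := by
    intro X
    calc Ψ (X * A) = Vᴴ * (X ⊗ₖ (1 : Matrix (Fin m) (Fin m) ℂ)) * ((A ⊗ₖ (1 : Matrix (Fin m) (Fin m) ℂ)) * V) := by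
          rw [hst, ← Matrix.mul_assoc, Matrix.mul_assoc Vᴴ (X ⊗ₖ _), ← mul_kronecker_mul,
            Matrix.one_mul]
      _ = Ψ X * Ψ A := by rw [hint, hst X, ← Matrix.mul_assoc]
  refine fun X => ⟨?_, hright X⟩
  have := congrArg conjTranspose (hright Xᴴ)
  rwa [conjTranspose_mul, hAH, hΨ, ← dual_complement_conjTranspose,
    ← dual_complement_conjTranspose, conjTranspose_mul, hA.eq, conjTranspose_conjTranspose] at this

/-- The multiplicative domain of a unital Hermitian-preserving map is a star subalgebra. -/
def multiplicativeDomainStarSubalgebra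
    (Ψ : Matrix (Fin r) (Fin r) ℂ →ₗ[ℂ] Matrix (Fin n) (Fin n) ℂ) (h1 : Ψ 1 = 1)
    (hs : ∀ A, Ψ Aᴴ = (Ψ A)ᴴ) : StarSubalgebra ℂ (Matrix (Fin r) (Fin r) ℂ) where
  carrier := multiplicativeDomain Ψ
  mul_mem' := fun {A B} hA hB X => by
    rw [Matrix.mul_assoc, (hA _).1, (hB _).1, (hA B).1, Matrix.mul_assoc, ← Matrix.mul_assoc X,
      (hB _).2, (hA _).2, Matrix.mul_assoc]
    exact ⟨rfl, rfl⟩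
  add_mem' := fun {A B} hA hB X => by
    simp only [Matrix.add_mul, Matrix.mul_add, map_add, (hA X).1, (hA X).2, (hB X).1, (hB X).2,
      and_self]
  algebraMap_mem' := fun c X => by
    simp only [Algebra.algebraMap_eq_smul_one, Matrix.smul_mul, Matrix.mul_smul, Matrix.one_mul,
      Matrix.mul_one, map_smul, h1, and_self]
  star_mem' := fun {A} hA X => by
    have h := hA Xᴴ
    constructor
    · have := congrArg conjTranspose h.2
      rwa [← hs, conjTranspose_mul, conjTranspose_mul, ← hs, ← hs,
        conjTranspose_conjTranspose] at this
    · have := congrArg conjTranspose h.1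
      rwa [← hs, conjTranspose_mul, conjTranspose_mul, ← hs, ← hs,
        conjTranspose_conjTranspose] at this

/-! ### Rank-one Kraus operators versus rank-one elements of the domain. -/

/-- When the Choi matrix is a projection, a minimal Kraus family has as many members as the rank
of the Choi matrix. -/
theorem IsMinimalKraus.eq_rank
    {Φ : Matrix (Fin n) (Fin n) ℂ →ₗ[ℂ] Matrix (Fin m) (Fin m) ℂ}
    (hproj : IsStarProjection (choiMatrix Φ)) {K : Fin r → Matrix (Fin m) (Fin n) ℂ}
    (hK : IsMinimalKraus Φ K) : (choiMatrix Φ).rank = r := by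
  apply le_antisymm
  · rw [(isKraus_iff_choiMatrix Φ K).mp hK.1, rank_self_mul_conjTranspose]
    exact (rank_le_card_width (krausMatrix K)).trans_eq (Fintype.card_fin r)
  · obtain ⟨Q, hQ, -⟩ := exists_isometry_of_isStarProjection hproj rfl
    exact hK.2 _ (fun l => Matrix.of fun a i => Q (i, a) l)
      ((isKraus_iff_choiMatrix Φ _).mpr hQ.symm)

/-- When the Choi matrix is a projection, a minimal Kraus family is orthonormal. -/
theorem IsMinimalKraus.conjTranspose_krausMatrix_mul_self
    {Φ : Matrix (Fin n) (Fin n) ℂ →ₗ[ℂ] Matrix (Fin m) (Fin m) ℂ}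
    (hproj : IsStarProjection (choiMatrix Φ)) {K : Fin r → Matrix (Fin m) (Fin n) ℂ}
    (hK : IsMinimalKraus Φ K) : (krausMatrix K)ᴴ * krausMatrix K = 1 :=
  conjTranspose_mul_self_eq_one_of_rank hproj (hK.eq_rank hproj)
    ((isKraus_iff_choiMatrix Φ K).mp hK.1).symm

/-- The dual of the complement with respect to orthonormal Kraus operators is
trace preserving. -/
theorem trace_dual_complement {K : Fin r → Matrix (Fin m) (Fin n) ℂ}
    (hK : (krausMatrix K)ᴴ * krausMatrix K = 1) (A : Matrix (Fin r) (Fin r) ℂ) :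
    (dual (complement K) A).trace = A.trace := by
  have : ∀ i j, ((K i)ᴴ * K j).trace = (1 : Matrix (Fin r) (Fin r) ℂ) i j := by
    intro i j
    rw [← hK, Matrix.mul_apply, Fintype.sum_prod_type]
    simp only [trace, diag_apply, Matrix.mul_apply, krausMatrix, conjTranspose_apply,
      Matrix.of_apply]
  simp only [dual_complement_eq_sum, trace_sum, trace_smul, this, Matrix.one_apply]
  simp [trace]

theorem krausMatrix_krausCombination {s : ℕ} (K : Fin r → Matrix (Fin m) (Fin n) ℂ)
    (c : Fin s → Fin r → ℂ) :
    krausMatrix (fun l => krausCombination K (c l)) =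
      krausMatrix K * (Matrix.of fun l i => c l i)ᴴ := by
  ext p l
  simp [krausMatrix, krausCombination, Matrix.mul_apply, Matrix.sum_apply, mul_comm]

theorem vecMulVec_mul_self {ι : Type*} [Fintype ι] (a b : ι → ℂ) :
    vecMulVec a b * vecMulVec a b = (vecMulVec a b).trace • vecMulVec a b := by
  rw [vecMulVec_mul_vecMulVec, vecMulVec_smul, trace_vecMulVec, dotProduct_comm]

/-- A rank-one Kraus combination yields a rank-one element of the multiplicative domain. -/
theorem vecMulVec_mem_multiplicativeDomain {K : Fin r → Matrix (Fin m) (Fin n) ℂ}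
    (h1 : dual (complement K) 1 = 1) (hK : (krausMatrix K)ᴴ * krausMatrix K = 1)
    {c : Fin r → ℂ} {u : Fin m → ℂ} {v : Fin n → ℂ}
    (hc : krausCombination K c = vecMulVec u (star v)) :
    vecMulVec c (star c) ∈ multiplicativeDomain (dual (complement K)) := by
  refine mem_multiplicativeDomain_of_isHermitian h1
    (by rw [Matrix.IsHermitian, conjTranspose_vecMulVec, star_star]) ?_
  have hΨ : dual (complement K) (vecMulVec c (star c)) =
      vecMulVec v ((star u ⬝ᵥ u) • star v) := by
    rw [dual_complement_vecMulVec, hc, conjTranspose_vecMulVec, star_star,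
      vecMulVec_mul_vecMulVec]
  -- A rank-one matrix squares to its trace times itself. Both cc^* and its image have rank at most
  -- one, and their traces agree.
  rw [vecMulVec_mul_self, map_smul, ← trace_dual_complement hK, hΨ, vecMulVec_mul_self]

/-- A unit vector whose projection lies in the multiplicative domain yields a rank-one Kraus
combination. -/
theorem exists_krausCombination_eq_vecMulVec {K : Fin r → Matrix (Fin m) (Fin n) ℂ}
    (hK : (krausMatrix K)ᴴ * krausMatrix K = 1) {c : Fin r → ℂ} (hc : star c ⬝ᵥ c = 1)
    (hcM : vecMulVec c (star c) ∈ multiplicativeDomain (dual (complement K))) :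
    ∃ (u : Fin m → ℂ) (v : Fin n → ℂ), krausCombination K c = vecMulVec u (star v) := by
  have htr : (vecMulVec c (star c)).trace = 1 := by rw [trace_vecMulVec, dotProduct_comm, hc]
  apply exists_eq_vecMulVec_of_trace_eq_one
  · rw [← dual_complement_vecMulVec]
    refine ⟨?_, ?_⟩
    · rw [IsIdempotentElem, ← (hcM _).1, vecMulVec_mul_self, htr, one_smul]
    · rw [IsSelfAdjoint, star_eq_conjTranspose, ← dual_complement_conjTranspose,
        conjTranspose_vecMulVec, star_star]
  · rw [← dual_complement_vecMulVec, trace_dual_complement hK, htr]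

/-- An orthonormal basis with projections in the multiplicative domain gives a rank-one Kraus
family of minimal size. -/
theorem exists_isKraus_vecMulVec
    {Φ : Matrix (Fin n) (Fin n) ℂ →ₗ[ℂ] Matrix (Fin m) (Fin m) ℂ}
    {K : Fin r → Matrix (Fin m) (Fin n) ℂ} (hΦ : IsKraus Φ K)
    (hK : (krausMatrix K)ᴴ * krausMatrix K = 1) {e : Fin r → Fin r → ℂ}
    (he : ∀ i j, star (e i) ⬝ᵥ e j = if i = j then 1 else 0)
    (heM : ∀ i, vecMulVec (e i) (star (e i)) ∈ multiplicativeDomain (dual (complement K))) :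
    ∃ (u : Fin r → Fin m → ℂ) (v : Fin r → Fin n → ℂ),
      IsKraus Φ fun i => vecMulVec (u i) (star (v i)) := by
  choose u v huv using fun i =>
    exists_krausCombination_eq_vecMulVec hK ((he i i).trans (if_pos rfl)) (heM i)
  refine ⟨u, v, ?_⟩
  rw [← funext huv, isKraus_iff_choiMatrix, krausMatrix_krausCombination,
    (isKraus_iff_choiMatrix Φ K).mp hΦ]
  -- An orthonormal family of full size is a unitary matrix, so it cancels in `W Eᴴ E Wᴴ`.
  have hE : (Matrix.of fun l i => e l i)ᴴ * (Matrix.of fun l i => e l i) = 1 := by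
    rw [mul_eq_one_comm]
    ext i j
    rw [Matrix.one_apply, if_congr eq_comm rfl rfl, ← he j i, dotProduct_comm]
    rfl
  rw [conjTranspose_mul, conjTranspose_conjTranspose, Matrix.mul_assoc, ← Matrix.mul_assoc _ᴴ,
    hE, Matrix.one_mul]

/-- A rank-one Kraus family gives spanning vectors with projections in the multiplicative
domain. -/
theorem exists_spanning_of_isKraus_vecMulVec
    {Φ : Matrix (Fin n) (Fin n) ℂ →ₗ[ℂ] Matrix (Fin m) (Fin m) ℂ}
    (hproj : IsStarProjection (choiMatrix Φ))
    {K : Fin r → Matrix (Fin m) (Fin n) ℂ} (hΦ : IsKraus Φ K)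
    (h1 : dual (complement K) 1 = 1) (hK : (krausMatrix K)ᴴ * krausMatrix K = 1) {N : ℕ}
    {u : Fin N → Fin m → ℂ} {v : Fin N → Fin n → ℂ}
    (huv : IsKraus Φ fun i => vecMulVec (u i) (star (v i))) :
    ∃ c : Fin N → Fin r → ℂ, ∑ l, vecMulVec (c l) (star (c l)) = 1 ∧
      ∀ l, vecMulVec (c l) (star (c l)) ∈ multiplicativeDomain (dual (complement K)) := by
  set W := krausMatrix K with hW
  set R := krausMatrix fun i => vecMulVec (u i) (star (v i)) with hR
  have hJW : choiMatrix Φ = W * Wᴴ := (isKraus_iff_choiMatrix Φ _).mp hΦ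
  have hJR : choiMatrix Φ = R * Rᴴ := (isKraus_iff_choiMatrix Φ _).mp huv
  have hJJ : choiMatrix Φ * choiMatrix Φ = choiMatrix Φ := hproj.isIdempotentElem
  -- The columns of `R` lie in the range of the Choi matrix, which the columns of `W` span; `Cᴴ`
  -- holds their coordinates.
  have hRJ : choiMatrix Φ * R = R := by
    have : (1 - choiMatrix Φ) * (R * Rᴴ) = 0 := by
      rw [← hJR, Matrix.sub_mul, hJJ, Matrix.one_mul, sub_self]
    rw [mul_self_mul_conjTranspose_eq_zero, Matrix.sub_mul, Matrix.one_mul, sub_eq_zero] at this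
    exact this.symm
  set C : Matrix (Fin N) (Fin r) ℂ := (Wᴴ * R)ᴴ with hC
  have hWC : W * Cᴴ = R := by
    rw [hC, conjTranspose_conjTranspose, ← Matrix.mul_assoc, ← hJW, hRJ]
  have hCC : Cᴴ * C = 1 := by
    rw [hC, conjTranspose_conjTranspose, conjTranspose_mul, conjTranspose_conjTranspose]
    calc Wᴴ * R * (Rᴴ * W) = Wᴴ * (R * Rᴴ) * W := by simp only [Matrix.mul_assoc]
      _ = (Wᴴ * W) * (Wᴴ * W) := by rw [← hJR, hJW]; simp only [Matrix.mul_assoc]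
      _ = 1 := by rw [hK, Matrix.one_mul]
  refine ⟨fun l i => C l i, ?_, fun l => ?_⟩
  · ext i j
    rw [Matrix.sum_apply, Matrix.one_apply, if_congr eq_comm rfl rfl, ← Matrix.one_apply, ← hCC,
      Matrix.mul_apply]
    exact Finset.sum_congr rfl fun l _ => mul_comm _ _
  · refine vecMulVec_mem_multiplicativeDomain h1 hK (u := u l) (v := v l) ?_
    have h := krausMatrix_krausCombination K fun l i => C l i
    have h' : krausMatrix (fun l => krausCombination K fun i => C l i) = R := h.trans hWC
    ext a i
    exact congr_fun (congr_fun h' (i, a)) l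

/-! ### Entanglement breaking maps and rank-one Kraus operators. -/

theorem trace_ampliation {n m : ℕ} (k : ℕ)
    {Φ : Matrix (Fin n) (Fin n) ℂ →ₗ[ℂ] Matrix (Fin m) (Fin m) ℂ}
    (htr : ∀ X, (Φ X).trace = X.trace) (X : Matrix (Fin k × Fin n) (Fin k × Fin n) ℂ) :
    (ampliation k Φ X).trace = X.trace := by
  rw [trace, trace, Fintype.sum_prod_type, Fintype.sum_prod_type]
  refine Finset.sum_congr rfl fun a _ => ?_
  exact htr (Matrix.of fun x y => X (a, x) (a, y))

/-- A positive semidefinite matrix is a nonnegative multiple of a state. -/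
theorem exists_smul_isState {ι : Type*} [Fintype ι] [Nonempty ι] {A : Matrix ι ι ℂ}
    (hA : A.PosSemidef) : ∃ (t : ℝ) (ρ : Matrix ι ι ℂ), 0 ≤ t ∧ IsState ρ ∧ A = (t : ℂ) • ρ := by
  classical
  have h0 : 0 ≤ A.trace := hA.trace_nonneg
  obtain ⟨t, ht0, ht⟩ : ∃ t : ℝ, 0 ≤ t ∧ A.trace = (t : ℂ) := by
    rw [Complex.le_def] at h0
    exact ⟨A.trace.re, h0.1, Complex.ext rfl h0.2.symm⟩
  rcases ht0.eq_or_lt with rfl | hpos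
  -- A trace-zero matrix vanishes, so the weight is 0 and any state serves.
  · obtain ⟨x⟩ := ‹Nonempty ι›
    refine ⟨0, vecMulVec (Pi.single x 1) (star (Pi.single x 1)), le_rfl,
      ⟨posSemidef_vecMulVec_self_star _, ?_⟩, ?_⟩
    · simp [trace_vecMulVec]
    · rw [Complex.ofReal_zero, zero_smul]
      exact hA.trace_eq_zero_iff.mp (by simpa using ht)
  · have htc : (t : ℂ) ≠ 0 := by exact_mod_cast hpos.ne'
    refine ⟨t, (t : ℂ)⁻¹ • A, ht0, ⟨hA.smul ?_, ?_⟩, ?_⟩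
    · rw [← Complex.ofReal_inv]
      exact_mod_cast inv_nonneg.mpr ht0
    · rw [trace_smul, ht, smul_eq_mul, inv_mul_cancel₀ htc]
    · rw [smul_smul, mul_inv_cancel₀ htc, one_smul]

/-- A state that is a sum of products of positive semidefinite matrices is separable. -/
theorem isSeparable_of_eq_sum {k m N : ℕ} {X : Matrix (Fin k × Fin m) (Fin k × Fin m) ℂ}
    (hX : X.trace = 1) {A : Fin N → Matrix (Fin k) (Fin k) ℂ}
    {B : Fin N → Matrix (Fin m) (Fin m) ℂ} (hA : ∀ i, (A i).PosSemidef)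
    (hB : ∀ i, (B i).PosSemidef) (h : X = ∑ i, A i ⊗ₖ B i) : IsSeparable X := by
  have hne : Nonempty (Fin k × Fin m) := by
    by_contra hne
    rw [not_nonempty_iff] at hne
    simp [trace] at hX
  have : Nonempty (Fin k) := hne.map Prod.fst
  have : Nonempty (Fin m) := hne.map Prod.snd
  choose t ρ ht hρ hAρ using fun i => exists_smul_isState (hA i)
  choose s σ hs hσ hBσ using fun i => exists_smul_isState (hB i)
  have hXp : X = ∑ i, ((t i * s i : ℝ) : ℂ) • (ρ i ⊗ₖ σ i) := by
    rw [h]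
    refine Finset.sum_congr rfl fun i _ => ?_
    conv_lhs => rw [hAρ, hBσ]
    rw [smul_kronecker, kronecker_smul, smul_smul, Complex.ofReal_mul]
  refine ⟨N, fun i => t i * s i, ρ, σ, fun i => mul_nonneg (ht i) (hs i), ?_, hρ, hσ, hXp⟩
  have := congrArg trace hXp
  simp only [hX, trace_sum, trace_smul, trace_kronecker, (hρ _).trace_eq_one,
    (hσ _).trace_eq_one, mul_one, smul_eq_mul] at this
  exact_mod_cast this.symm

/-- A trace-preserving map with rank-one Kraus operators is entanglement breaking. -/
theorem isEntanglementBreaking_of_isKraus_vecMulVec {n m N : ℕ}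
    {Φ : Matrix (Fin n) (Fin n) ℂ →ₗ[ℂ] Matrix (Fin m) (Fin m) ℂ}
    (htr : ∀ X, (Φ X).trace = X.trace) {u : Fin N → Fin m → ℂ} {v : Fin N → Fin n → ℂ}
    (h : IsKraus Φ fun i => vecMulVec (u i) (star (v i))) : IsEntanglementBreaking Φ := by
  intro k _ X hX
  -- `V i` is 1 ⊗ v_i, so conjugating by it contracts the second tensor factor against v_i.
  let V : Fin N → Matrix (Fin k × Fin n) (Fin k) ℂ := fun i =>
    Matrix.of fun p b => if p.1 = b then v i p.2 else 0
  refine isSeparable_of_eq_sum (A := fun i => (V i)ᴴ * X * V i)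
    (B := fun i => vecMulVec (u i) (star (u i))) ((trace_ampliation k htr X).trans hX.2)
    (fun i => hX.1.conjTranspose_mul_mul_same _) (fun i => posSemidef_vecMulVec_self_star _) ?_
  ext p q
  simp only [ampliation, Matrix.of_apply, h _, Matrix.sum_apply, conjTranspose_vecMulVec,
    star_star, vecMulVec_mul_mul_vecMulVec, Matrix.smul_apply, kroneckerMap_apply, smul_eq_mul]
  refine Finset.sum_congr rfl fun i _ => ?_
  congr 1
  rw [Matrix.mul_assoc, Matrix.mul_apply, Fintype.sum_prod_type]
  simp [V, Matrix.mul_apply, Fintype.sum_prod_type, dotProduct, mulVec,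
    apply_ite star, ite_mul]

/-- A decomposition of the Choi matrix into products of rank-one matrices gives rank-one Kraus
operators. -/
theorem exists_isKraus_vecMulVec_of_choiMatrix_eq {n m : ℕ}
    {Φ : Matrix (Fin n) (Fin n) ℂ →ₗ[ℂ] Matrix (Fin m) (Fin m) ℂ} {κ : Type*} [Fintype κ]
    {x : κ → Fin n → ℂ} {y : κ → Fin m → ℂ}
    (h : choiMatrix Φ = ∑ l, vecMulVec (x l) (star (x l)) ⊗ₖ vecMulVec (y l) (star (y l))) :
    ∃ (N : ℕ) (u : Fin N → Fin m → ℂ) (v : Fin N → Fin n → ℂ),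
      IsKraus Φ fun i => vecMulVec (u i) (star (v i)) := by
  let g := (Fintype.equivFin κ).symm
  -- The conjugate on `x` undoes the one in u v^*, so that vectorizing gives x ⊗ y.
  refine ⟨_, fun l => y (g l), fun l => star (x (g l)), (isKraus_iff_choiMatrix Φ _).mpr ?_⟩
  ext p q
  rw [h, Matrix.sum_apply, Matrix.mul_apply, ← g.sum_comp]
  refine Finset.sum_congr rfl fun l _ => ?_
  simp only [krausMatrix, kroneckerMap_apply, vecMulVec_apply, conjTranspose_apply,
    Matrix.of_apply, Pi.star_apply, star_star, star_mul']
  ring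

/-- An entanglement breaking map has rank-one Kraus operators. -/
theorem IsEntanglementBreaking.exists_isKraus_vecMulVec {n m : ℕ} (hn : 1 ≤ n)
    {Φ : Matrix (Fin n) (Fin n) ℂ →ₗ[ℂ] Matrix (Fin m) (Fin m) ℂ}
    (h : IsEntanglementBreaking Φ) :
    ∃ (N : ℕ) (u : Fin N → Fin m → ℂ) (v : Fin N → Fin n → ℂ),
      IsKraus Φ fun i => vecMulVec (u i) (star (v i)) := by
  have hn0 : (n : ℂ) ≠ 0 := by exact_mod_cast (by omega : n ≠ 0)
  -- The unnormalized maximally entangled vector, whose projection is sent to the Choi matrix.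
  let δ : Fin n × Fin n → ℂ := fun p => if p.1 = p.2 then 1 else 0
  have hδ : IsState ((n : ℂ)⁻¹ • vecMulVec δ (star δ)) := by
    constructor
    · refine (posSemidef_vecMulVec_self_star δ).smul ?_
      exact inv_nonneg.mpr n.cast_nonneg
    · rw [trace_smul, trace_vecMulVec]
      simp [δ, dotProduct, Fintype.sum_prod_type, hn0]
  have hamp : ampliation n Φ ((n : ℂ)⁻¹ • vecMulVec δ (star δ)) =
      (n : ℂ)⁻¹ • choiMatrix Φ := by
    ext p q
    rw [Matrix.smul_apply, choiMatrix_apply, ampliation, Matrix.of_apply]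
    have : (Matrix.of fun x y => ((n : ℂ)⁻¹ • vecMulVec δ (star δ)) (p.1, x) (q.1, y)) =
        (n : ℂ)⁻¹ • single p.1 q.1 (1 : ℂ) := by
      ext x y
      by_cases hx : p.1 = x <;> by_cases hy : q.1 = y <;>
        simp [δ, vecMulVec_apply, hx, hy]
    rw [this, map_smul, Matrix.smul_apply]
  obtain ⟨N, p, ρ, σ, hp, -, hρ, hσ, hsum⟩ := h n hn _ hδ
  rw [hamp] at hsum
  have hchoi : choiMatrix Φ = ∑ i, (((n : ℝ) * p i : ℝ) : ℂ) • ρ i ⊗ₖ σ i := by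
    have := congrArg (fun M => (n : ℂ) • M) hsum
    simp only [smul_smul, mul_inv_cancel₀ hn0, one_smul, Finset.smul_sum] at this
    rw [this]
    refine Finset.sum_congr rfl fun i _ => ?_
    push_cast
    rfl
  have hPS : ∀ i, ((((n : ℝ) * p i : ℝ) : ℂ) • ρ i).PosSemidef := fun i =>
    (hρ i).1.smul (by exact_mod_cast mul_nonneg n.cast_nonneg (hp i))
  choose a x hx using fun i => posSemidef_iff_eq_sum_vecMulVec.mp (hPS i)
  choose b y hy using fun i => posSemidef_iff_eq_sum_vecMulVec.mp (hσ i).1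
  refine exists_isKraus_vecMulVec_of_choiMatrix_eq (κ := Σ i, Fin (a i) × Fin (b i))
    (x := fun l => x l.1 l.2.1) (y := fun l => y l.1 l.2.2) ?_
  rw [hchoi, Fintype.sum_sigma]
  refine Finset.sum_congr rfl fun i _ => ?_
  rw [← smul_kronecker, hx, hy, Fintype.sum_prod_type]
  ext p q
  simp only [kroneckerMap_apply, Matrix.sum_apply, Finset.sum_mul_sum]

/-! ### Basis projections in the multiplicative domain, and the theorem. -/

/-- A set unitarily equivalent to a multiplicity-free direct sum of matrix algebras contains the
projections onto the vectors of an orthonormal basis. -/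
theorem UnitarilyEquivalent.exists_orthonormal {r M : ℕ} {j : Fin M → ℕ}
    {S : Set (Matrix (Fin r) (Fin r) ℂ)} (h : UnitarilyEquivalent S (directSumAlgebra j)) :
    ∃ e : Fin r → Fin r → ℂ, (∀ i j, star (e i) ⬝ᵥ e j = if i = j then 1 else 0) ∧
      ∀ i, vecMulVec (e i) (star (e i)) ∈ S := by
  obtain ⟨U, hU, hU', rfl⟩ := h
  have hcard : Fintype.card (Fin r) = Fintype.card (Σ k, Fin (j k)) := by
    have := trace_mul_comm U Uᴴ
    rw [hU, hU', trace_one, trace_one] at this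
    exact_mod_cast this
  let g := Fintype.equivOfCardEq hcard
  refine ⟨fun l x => U x (g l), fun l l' => ?_, fun l => ?_⟩
  · have := congr_fun (congr_fun hU' (g l)) (g l')
    refine Eq.trans this ?_
    simp only [Matrix.one_apply, g.injective.eq_iff]
  -- Multiplicity one enters here: each diagonal matrix unit is itself block diagonal, and `U`
  -- carries it to the projection onto a column of `U`.
  · refine ⟨single (g l) (g l) 1, ⟨Pi.single (g l).1 (single (g l).2 (g l).2 1), ?_⟩, ?_⟩
    · dsimp only
      generalize g l = p
      obtain ⟨k, a⟩ := p
      ext ⟨k₁, b⟩ ⟨k₂, c⟩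
      by_cases hk : k₁ = k₂
      · subst hk
        rw [blockDiagonal'_apply_eq]
        by_cases hk' : k = k₁
        · subst hk'
          simp [single_apply]
        · simp [hk']
      · rw [blockDiagonal'_apply_ne _ _ _ hk, single_apply, if_neg]
        rintro ⟨h1, h2⟩
        exact hk ((congrArg Sigma.fst h1).symm.trans (congrArg Sigma.fst h2))
    · dsimp only
      rw [mul_mul_conjTranspose_eq_sum, Finset.sum_eq_single (g l),
        Finset.sum_eq_single (g l)]
      · simp
      · intro q _ hq
        simp [hq.symm]
      · simp
      · intro p _ hp
        exact Finset.sum_eq_zero fun q _ => by simp [hp.symm]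
      · simp

/-- For a minimal Kraus family of an entanglement breaking channel whose Choi matrix is a
projection, the multiplicative domain contains the projections of an orthonormal basis. -/
theorem IsEntanglementBreaking.exists_orthonormal {n m r : ℕ} (hn : 1 ≤ n)
    {Φ : Matrix (Fin n) (Fin n) ℂ →ₗ[ℂ] Matrix (Fin m) (Fin m) ℂ}
    (hEB : IsEntanglementBreaking Φ) (htr : ∀ X, (Φ X).trace = X.trace)
    (hproj : IsStarProjection (choiMatrix Φ))
    {K : Fin r → Matrix (Fin m) (Fin n) ℂ} (hK : IsMinimalKraus Φ K) :
    ∃ e : Fin r → Fin r → ℂ, (∀ i j, star (e i) ⬝ᵥ e j = if i = j then 1 else 0) ∧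
      ∀ i, vecMulVec (e i) (star (e i)) ∈ multiplicativeDomain (dual (complement K)) := by
  obtain ⟨N, u, v, huv⟩ := hEB.exists_isKraus_vecMulVec hn
  have h1 := dual_complement_one htr hK.1
  obtain ⟨c, hc, hcM⟩ := exists_spanning_of_isKraus_vecMulVec hproj hK.1 h1
    (hK.conjTranspose_krausMatrix_mul_self hproj) huv
  exact exists_orthonormal_of_spanning
    (multiplicativeDomainStarSubalgebra _ h1 (dual_complement_conjTranspose K)) c hc hcM r
    (Fintype.card_fin r).ge

end EntBreak

theorem theorem3 (n m d : ℕ) (hn : 1 ≤ n)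
    (Φ : Matrix (Fin n) (Fin n) ℂ →ₗ[ℂ] Matrix (Fin m) (Fin m) ℂ)
    (hΦ : EntBreak.IsChannel Φ)
    (hproj : IsStarProjection (EntBreak.choiMatrix Φ))
    (hrank : (EntBreak.choiMatrix Φ).rank = d) :
    (∀ (r : ℕ) (K : Fin r → Matrix (Fin m) (Fin n) ℂ), EntBreak.IsMinimalKraus Φ K →
      (EntBreak.IsEntanglementBreaking Φ ↔
        ∃ (M : ℕ) (j : Fin M → ℕ), (∀ k, 1 ≤ j k) ∧
          EntBreak.UnitarilyEquivalent
            (EntBreak.multiplicativeDomain (EntBreak.dual (EntBreak.complement K)))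
            (EntBreak.directSumAlgebra j))) ∧
    (EntBreak.IsEntanglementBreaking Φ →
      EntBreak.ebRank Φ = EntBreak.choiRank Φ ∧ EntBreak.choiRank Φ = d) := by
  have htr := hΦ.tracePreserving
  refine ⟨fun r K hK => ⟨fun hEB => ?_, ?_⟩, fun hEB => ?_⟩
  · obtain ⟨e, he, heM⟩ := hEB.exists_orthonormal hn htr hproj hK
    exact EntBreak.exists_unitarilyEquivalent_directSumAlgebra
      (EntBreak.multiplicativeDomainStarSubalgebra _ (EntBreak.dual_complement_one htr hK.1)
        (EntBreak.dual_complement_conjTranspose K)) e he heM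
  · rintro ⟨M, j, -, hU⟩
    obtain ⟨e, he, heM⟩ := hU.exists_orthonormal
    obtain ⟨u, v, huv⟩ := EntBreak.exists_isKraus_vecMulVec hK.1
      (hK.conjTranspose_krausMatrix_mul_self hproj) he heM
    exact EntBreak.isEntanglementBreaking_of_isKraus_vecMulVec htr huv
  · obtain ⟨N, u₀, v₀, h₀⟩ := hEB.exists_isKraus_vecMulVec hn
    -- The infimum of an empty set of naturals is 0, so attaining the Choi rank needs an existing
    -- family, here the rank-one family `h₀`.
    obtain ⟨K, hK⟩ : ∃ K : Fin (EntBreak.choiRank Φ) → Matrix (Fin m) (Fin n) ℂ,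
        EntBreak.IsKraus Φ K :=
      Nat.sInf_mem (s := {r | ∃ K : Fin r → Matrix (Fin m) (Fin n) ℂ, EntBreak.IsKraus Φ K})
        ⟨N, _, h₀⟩
    have hmin : EntBreak.IsMinimalKraus Φ K := ⟨hK, fun s L hL => Nat.sInf_le ⟨L, hL⟩⟩
    obtain ⟨e, he, heM⟩ := hEB.exists_orthonormal hn htr hproj hmin
    obtain ⟨u, v, huv⟩ := EntBreak.exists_isKraus_vecMulVec hK
      (hmin.conjTranspose_krausMatrix_mul_self hproj) he heM
    refine ⟨le_antisymm (Nat.sInf_le ⟨u, v, huv⟩) ?_, (hmin.eq_rank hproj).symm.trans hrank⟩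
    refine le_csInf ⟨_, u, v, huv⟩ ?_
    rintro s ⟨u', v', h'⟩
    exact hmin.2 s _ h'
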